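/- Let $q=2^n$, let $k\ge 3$ be an odd integer with $\gcd(k,n)=1$, and let $d=2^k+1$. Let $g\in\mathbb{F}_q[x]$ have degree $2^{k-1}+2$, let $f(x)=x^d+g(x)$, and let $$\phi(x,y,z)=\frac{f(x)+f(y)+f(z)+f(x+y+z)}{(x+y)(x+z)(y+z)}\in\mathbb{F}_q[x,y,z].$$ A polynomial over $\mathbb{F}_q$ is called absolutely irreducible if it is irreducible over an algebraic closure of $\mathbb{F}_q$. Call a polynomial $L\in\mathbb{F}_q[x]$ $2$-affine if every exponent occurring in it is $0$ or a power of $2$, i.e. $L(x)=c+\sum_i b_i x^{2^i}$ (a finite sum). 1. If $g$ is not of the form $g(x)=a x^{2^{k-1}+2}+a^2x^3+L(x)$ with $a\in\mathbb{F}_q$ and $L\in\mathbb{F}_q[x]$ a $2$-affine polynomial, then $\phi$ is absolutely irreducible. 2. If $g$ is of this form (in particular if $g(x)=a x^{2^{k-1}+2}+a^2x^3$), then either $\phi$ is absolutely irreducible, or $\phi=PQ$ with $P,Q\in\mathbb{F}_q[x,y,z]$ both absolutely irreducible. -/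

import Mathlib

open Polynomial

noncomputable section

/-- The numerator `f(x) + f(y) + f(z) + f(x+y+z)`, where `x, y, z` are the three variables
`X 0, X 1, X 2` of `MvPolynomial (Fin 3) F`. -/
def phiNum {F : Type*} [Field F] (f : F[X]) : MvPolynomial (Fin 3) F :=
  aeval (MvPolynomial.X 0) f + aeval (MvPolynomial.X 1) f + aeval (MvPolynomial.X 2) f
    + aeval (MvPolynomial.X 0 + MvPolynomial.X 1 + MvPolynomial.X 2) f

/-- The denominator `(x+y)(x+z)(y+z)`. -/
def phiDen (F : Type*) [Field F] : MvPolynomial (Fin 3) F :=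
  (MvPolynomial.X 0 + MvPolynomial.X 1) * (MvPolynomial.X 0 + MvPolynomial.X 2)
    * (MvPolynomial.X 1 + MvPolynomial.X 2)

/-- In characteristic 2, `(x+y)(x+z)(y+z)` divides `x^j + y^j + z^j + (x+y+z)^j`. -/
theorem phiDen_dvd_pow {R : Type*} [CommRing R] [CharP R 2] (x y z : R) (j : ℕ) :
    (x + y) * (x + z) * (y + z) ∣ x ^ j + y ^ j + z ^ j + (x + y + z) ^ j := by
  have h2 : (2 : R) = 0 := CharTwo.two_eq_zero
  induction j using Nat.strong_induction_on with
  | _ j ih =>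
    match j, ih with
    | 0, _ => exact ⟨0, by linear_combination 2 * h2⟩
    | 1, _ => exact ⟨0, by linear_combination (x + y + z) * h2⟩
    | 2, _ => exact ⟨0, by linear_combination (x^2 + y^2 + z^2 + x*y + x*z + y*z) * h2⟩
    | 3, _ => exact ⟨1, by
        linear_combination (x^3 + y^3 + z^3 + (x + y) * (x + z) * (y + z)) * h2⟩
    | (i + 4), ih =>
      have e3 := ih (i + 3) (by omega)
      have e2 := ih (i + 2) (by omega)
      have e1 := ih (i + 1) (by omega)
      have e0 := ih i (by omega)
      have key : x ^ (i+4) + y ^ (i+4) + z ^ (i+4) + (x + y + z) ^ (i+4)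
          = 2 * (x + y + z) * (x ^ (i+3) + y ^ (i+3) + z ^ (i+3) + (x + y + z) ^ (i+3))
          - (x*y + x*z + y*z + (x + y + z) * (x + y + z))
              * (x ^ (i+2) + y ^ (i+2) + z ^ (i+2) + (x + y + z) ^ (i+2))
          + (x*y*z + (x*y + x*z + y*z) * (x + y + z))
              * (x ^ (i+1) + y ^ (i+1) + z ^ (i+1) + (x + y + z) ^ (i+1))
          - (x*y*z*(x + y + z)) * (x ^ i + y ^ i + z ^ i + (x + y + z) ^ i) := by
        simp only [pow_succ]
        ring
      rw [key]
      exact dvd_sub (dvd_add (dvd_sub (e3.mul_left _) (e2.mul_left _)) (e1.mul_left _))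
        (e0.mul_left _)

theorem phiDen_dvd_phiNum {F : Type*} [Field F] [CharP F 2] (f : F[X]) :
    phiDen F ∣ phiNum f := by
  induction f using Polynomial.induction_on' with
  | add p q hp hq =>
    have : phiNum (p + q) = phiNum p + phiNum q := by
      simp only [phiNum, map_add]; ring
    rw [this]; exact dvd_add hp hq
  | monomial j a =>
    have h := phiDen_dvd_pow (MvPolynomial.X 0 : MvPolynomial (Fin 3) F)
      (MvPolynomial.X 1) (MvPolynomial.X 2) j
    have : phiNum (monomial j a) = algebraMap F (MvPolynomial (Fin 3) F) a *
        (MvPolynomial.X 0 ^ j + MvPolynomial.X 1 ^ j + MvPolynomial.X 2 ^ j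
          + (MvPolynomial.X 0 + MvPolynomial.X 1 + MvPolynomial.X 2) ^ j) := by
      simp only [phiNum, aeval_monomial]; ring
    rw [this]; exact h.mul_left _

/-- The polynomial
`φ(x,y,z) = (f(x) + f(y) + f(z) + f(x+y+z)) / ((x+y)(x+z)(y+z))` in `F[x,y,z]`
(exact division, for a field `F` of characteristic 2). -/
def phi {F : Type*} [Field F] [CharP F 2] (f : F[X]) : MvPolynomial (Fin 3) F :=
  (phiDen_dvd_phiNum f).choose

theorem phiDen_mul_phi {F : Type*} [Field F] [CharP F 2] (f : F[X]) :
    phiDen F * phi f = phiNum f :=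
  (phiDen_dvd_phiNum f).choose_spec.symm

theorem X_add_X_ne_zero {F : Type*} [Field F] {i j : Fin 3} (h : i ≠ j) :
    (MvPolynomial.X i + MvPolynomial.X j : MvPolynomial (Fin 3) F) ≠ 0 := by
  intro h0
  have := congrArg (MvPolynomial.eval (fun l : Fin 3 => if l = i then (1 : F) else 0)) h0
  simp [h.symm] at this

theorem phiDen_ne_zero (F : Type*) [Field F] : phiDen F ≠ 0 :=
  mul_ne_zero (mul_ne_zero (X_add_X_ne_zero (by decide)) (X_add_X_ne_zero (by decide)))
    (X_add_X_ne_zero (by decide))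

/-- `phi f` is the only polynomial whose product with the denominator is the numerator. -/
theorem phi_unique {F : Type*} [Field F] [CharP F 2] (f : F[X])
    (p : MvPolynomial (Fin 3) F) (hp : phiDen F * p = phiNum f) : p = phi f :=
  mul_left_cancel₀ (phiDen_ne_zero F) (hp.trans (phiDen_mul_phi f).symm)

/-- A polynomial over `F` is absolutely irreducible if it is irreducible over an algebraic
closure of `F`. -/
def AbsolutelyIrreducible {F : Type*} [Field F] (p : MvPolynomial (Fin 3) F) : Prop :=
  Irreducible (MvPolynomial.map (algebraMap F (AlgebraicClosure F)) p)

/-- `L` is a 2-affine polynomial `c + ∑ᵢ bᵢ x^(2^i)`: every exponent that occurs in it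
is `0` or a power of `2`. -/
def IsTwoAffine {F : Type*} [Field F] (L : F[X]) : Prop :=
  ∀ j : ℕ, L.coeff j ≠ 0 → j = 0 ∨ ∃ i : ℕ, j = 2 ^ i

/-- `g` has the form `a x^(2^(k-1)+2) + a^2 x^3`, up to adding a 2-affine polynomial. -/
def HasBoundaryForm {F : Type*} [Field F] (k : ℕ) (g : F[X]) : Prop :=
  ∃ (a : F) (L : F[X]), IsTwoAffine L ∧
    g = C a * X ^ (2 ^ (k - 1) + 2) + C (a ^ 2) * X ^ 3 + L

end

/-!
Write `d = 2^k + 1`, `m = 2^(k-1) + 2`, `e = 2^(k-1) - 1`, so that `d = 2 e + 3` and `m = e + 3`, and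
let `φ_j` be the form of degree `j - 3` that `x^j` contributes to `phi`. The top form of `phi f` is
`φ_d`, of degree `2 e`, and the next form that may be nonzero is `a φ_m`, of degree `e`, where `a` is
the leading coefficient of `g`.

Restricted to the plane `z = 0` and dehomogenized (`planeRestriction`), the forms satisfy
`(A^2 + A) φ_d = A^(2^k) + A`, which is separable, and `(A^2 + A) φ_m = A^(2^(k-1)) + A^2`. Let
`phi f = P Q` be a proper factorization over the algebraic closure. The leading forms of `P` and `Q`
are coprime, since their product is separable, and they divide the forms next to them up to the gap
of length `e`; hence `P` and `Q` have the same gap (`gap_of_mul_gap`). In degree `e` this gives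
`P_top Q' + P' Q_top = a φ_m`. If `Q` had degree less than `e`, then `Q_top` would divide both `φ_d`
and `φ_m`; but as `k` is odd a common root of these lies in `𝔽₂` (`sq_eq_self_of_pow_eq`), where
`φ_d` does not vanish. So `P` and `Q` both have degree `e`, and each is its leading form plus a
constant, at least on the plane. Therefore all forms of `phi f` except those of degrees `2 e`, `e`
and `0` vanish, and the two lowest coefficients in `A` show that the constant is `a^2`
(`mul_eq_sq_of_lowest_coeffs`): `g` has the boundary form (`boundary_of_mul`).

Since every proper factor has degree `e`, both `P` and `Q` are irreducible, and the Frobenius of `F`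
preserves or exchanges their classes. It cannot exchange them: the roots of `P_top` lie in
`𝔽_(2^k)` and are fixed by the `k`-th power of Frobenius, which for odd `k` would also move them to
roots of `Q_top` (`not_frobenius_swap`). So `P` is preserved up to a constant, and a rescaling
defines both factors over `F` (`exists_factorization_of_map_phi_eq_mul`).
-/

/-! ### Restriction to a plane -/

/-- Restriction of a polynomial in three variables to the plane `z = 0`, in the coordinates
`x = A t`, `y = t`. The outer variable of `K[X][X]` is `t`, the inner one is `A`; the coefficient
of `t ^ i` is the homogeneous component of degree `i`, evaluated at `(A, 1, 0)`. -/
noncomputable def planeRestriction (K : Type*) [CommRing K] :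
    MvPolynomial (Fin 3) K →+* K[X][X] :=
  MvPolynomial.eval₂Hom (C.comp C) ![C X * X, X, 0]

section Plane

variable {K : Type*} [CommRing K]

theorem planeRestriction_X_zero : planeRestriction K (MvPolynomial.X 0) = C X * X := by
  simp [planeRestriction]

theorem planeRestriction_X_one : planeRestriction K (MvPolynomial.X 1) = X := by
  simp [planeRestriction]

theorem planeRestriction_X_two : planeRestriction K (MvPolynomial.X 2) = 0 := by
  simp [planeRestriction]

theorem planeRestriction_C (c : K) : planeRestriction K (MvPolynomial.C c) = C (C c) := by
  simp [planeRestriction]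

theorem planeRestriction_map {L : Type*} [CommRing L] (σ : K →+* L)
    (P : MvPolynomial (Fin 3) K) :
    planeRestriction L (MvPolynomial.map σ P) =
      (planeRestriction K P).map (mapRingHom σ) := by
  induction P using MvPolynomial.induction_on with
  | C a => simp [planeRestriction_C]
  | add p q hp hq => simp [hp, hq]
  | mul_X p i hp =>
    have hi : planeRestriction L (MvPolynomial.X i) =
        (planeRestriction K (MvPolynomial.X i)).map (mapRingHom σ) := by
      fin_cases i
      · simp [planeRestriction_X_zero]
      · simp [planeRestriction_X_one]
      · simp [planeRestriction_X_two]
    simp [hp, hi]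

theorem natDegree_coeff_planeRestriction_le (P : MvPolynomial (Fin 3) K) (i : ℕ) :
    ((planeRestriction K P).coeff i).natDegree ≤ i := by
  induction P using MvPolynomial.induction_on generalizing i with
  | C a =>
    rw [planeRestriction_C, coeff_C]
    split_ifs <;> simp
  | add p q hp hq =>
    rw [map_add, coeff_add]
    exact natDegree_add_le_of_degree_le (hp i) (hq i)
  | mul_X p j hp =>
    rw [map_mul]
    fin_cases j
    · simp only [Fin.zero_eta, planeRestriction_X_zero]
      rw [← mul_assoc]
      cases i with
      | zero => simp
      | succ i =>
        rw [coeff_mul_X, coeff_mul_C]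
        exact natDegree_mul_le.trans (add_le_add (hp i) natDegree_X_le)
    · simp only [Fin.mk_one, planeRestriction_X_one]
      cases i with
      | zero => simp
      | succ i =>
        rw [coeff_mul_X]
        exact (hp i).trans (Nat.le_succ i)
    · simp [planeRestriction_X_two]

theorem natDegree_planeRestriction_le (P : MvPolynomial (Fin 3) K) :
    (planeRestriction K P).natDegree ≤ P.totalDegree := by
  have h : planeRestriction K P =
      MvPolynomial.aeval (![C X * X, X, 0] : Fin 3 → K[X][X]) (MvPolynomial.map C P) := by
    rw [MvPolynomial.aeval_def, MvPolynomial.eval₂_map]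
    rfl
  have hdeg : (MvPolynomial.map (C : K →+* K[X]) P).totalDegree ≤ P.totalDegree :=
    Finset.sup_mono (MvPolynomial.support_map_subset _ _)
  rw [h, ← mul_one P.totalDegree]
  refine MvPolynomial.aeval_natDegree_le _ hdeg _ fun j => ?_
  fin_cases j
  · exact (natDegree_C_mul_le _ _).trans natDegree_X_le
  · exact natDegree_X_le
  · simp

theorem coeff_planeRestriction_aeval (f : K[X]) (j : ℕ) (hj : j ≠ 0) :
    (planeRestriction K (aeval (MvPolynomial.X 0) f + aeval (MvPolynomial.X 1) f +
      aeval (MvPolynomial.X 2) f +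
      aeval (MvPolynomial.X 0 + MvPolynomial.X 1 + MvPolynomial.X 2) f)).coeff j =
      C (f.coeff j) * (X ^ j + 1 + (X + 1) ^ j) := by
  have key : ∀ (v : MvPolynomial (Fin 3) K) (r : K[X]), planeRestriction K v = C r * X →
      (planeRestriction K (aeval v f)).coeff j = C (f.coeff j) * r ^ j := by
    intro v r hv
    have : planeRestriction K (aeval v f) = (f.map C).comp (C r * X) := by
      rw [aeval_def, hom_eval₂, hv, comp, eval₂_map]
      congr 1
      ext; simp [MvPolynomial.algebraMap_eq, planeRestriction_C]
    rw [this, comp_C_mul_X_coeff, coeff_map]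
  rw [map_add, map_add, map_add, coeff_add, coeff_add, coeff_add,
    key _ X planeRestriction_X_zero, key _ 1 (by simp [planeRestriction_X_one]),
    key _ 0 (by simp [planeRestriction_X_two]),
    key _ (X + 1) (by
      simp [planeRestriction_X_zero, planeRestriction_X_one, planeRestriction_X_two]; ring),
    zero_pow hj]
  ring

end Plane

theorem planeRestriction_phiDen (K : Type*) [Field K] :
    planeRestriction K (phiDen K) = C (X ^ 2 + X) * X ^ 3 := by
  simp only [phiDen, map_mul, map_add, planeRestriction_X_zero, planeRestriction_X_one,
    planeRestriction_X_two, map_pow]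
  ring

section PhiPlane

variable {K : Type*} [Field K] [CharP K 2]

/-- The coefficient of `t ^ i` in the restriction of `phi f`, up to the factor `A ^ 2 + A` coming
from the denominator `(x + y)(x + z)(y + z)`. -/
theorem coeff_planeRestriction_phi (f : K[X]) (i : ℕ) :
    (X ^ 2 + X) * (planeRestriction K (phi f)).coeff i =
      C (f.coeff (i + 3)) * (X ^ (i + 3) + 1 + (X + 1) ^ (i + 3)) := by
  rw [← coeff_planeRestriction_aeval f (i + 3) (by omega), ← phiNum, ← phiDen_mul_phi, map_mul,
    planeRestriction_phiDen,
    mul_assoc, coeff_C_mul, mul_comm (X ^ 3 : K[X][X]), coeff_mul_X_pow]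

theorem totalDegree_phi_add_three_le (f : K[X]) :
    (phi f).totalDegree + 3 ≤ max f.natDegree 3 := by
  by_cases h0 : phi f = 0
  · simp [h0]
  have hnum : (phiNum f).totalDegree ≤ f.natDegree := by
    have key : ∀ v : MvPolynomial (Fin 3) K, v.totalDegree ≤ 1 →
        (aeval v f).totalDegree ≤ f.natDegree := by
      intro v hv
      rw [aeval_eq_sum_range]
      refine MvPolynomial.totalDegree_finsetSum_le fun j hj => ?_
      refine (MvPolynomial.totalDegree_smul_le _ _).trans
        ((MvPolynomial.totalDegree_pow _ _).trans ?_)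
      rw [Finset.mem_range] at hj
      nlinarith
    have hX : ∀ i : Fin 3, (MvPolynomial.X i : MvPolynomial (Fin 3) K).totalDegree ≤ 1 :=
      fun i => (MvPolynomial.totalDegree_X i).le
    have hadd : ∀ {p q : MvPolynomial (Fin 3) K} {m : ℕ}, p.totalDegree ≤ m → q.totalDegree ≤ m →
        (p + q).totalDegree ≤ m := fun hp hq =>
      (MvPolynomial.totalDegree_add _ _).trans (max_le hp hq)
    exact hadd (hadd (hadd (key _ (hX 0)) (key _ (hX 1))) (key _ (hX 2)))
      (key _ (hadd (hadd (hX 0) (hX 1)) (hX 2)))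
  have hden : 3 ≤ (phiDen K).totalDegree := by
    have hne : (X ^ 2 + X : K[X]) ≠ 0 := by
      intro h
      simpa [coeff_X, coeff_X_pow] using congrArg (fun p => coeff p 1) h
    calc 3 = (planeRestriction K (phiDen K)).natDegree := by
          rw [planeRestriction_phiDen, natDegree_C_mul_X_pow _ _ hne]
      _ ≤ _ := natDegree_planeRestriction_le _
  have h := MvPolynomial.totalDegree_mul_of_isDomain (phiDen_ne_zero K) h0
  rw [phiDen_mul_phi] at h
  omega

theorem map_phi {L : Type*} [Field L] [CharP L 2] (σ : K →+* L) (f : K[X]) :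
    MvPolynomial.map σ (phi f) = phi (f.map σ) := by
  apply phi_unique
  have hden : phiDen L = MvPolynomial.map σ (phiDen K) := by simp [phiDen]
  have key : ∀ v : MvPolynomial (Fin 3) K,
      MvPolynomial.map σ (aeval v f) = aeval (MvPolynomial.map σ v) (f.map σ) := by
    intro v
    rw [aeval_def, hom_eval₂, aeval_def, eval₂_map]
    congr 1
    ext; simp [MvPolynomial.algebraMap_eq]
  rw [hden, ← map_mul, phiDen_mul_phi]
  simp [phiNum, key]

/-- In characteristic `2`, `x ^ j` is additive only if `j` is a power of `2`. -/
theorem eq_two_pow_of_X_pow_additive {j : ℕ} (hj : j ≠ 0)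
    (h : (X ^ j + 1 + (X + 1) ^ j : K[X]) = 0) : ∃ i : ℕ, j = 2 ^ i := by
  obtain ⟨v, m, hm, rfl⟩ := Nat.exists_eq_two_pow_mul_odd hj
  refine ⟨v, ?_⟩
  have h1 : (X ^ m + 1 + (X + 1) ^ m : K[X]) = 0 := by
    have : (X ^ m + 1 + (X + 1) ^ m : K[X]) ^ 2 ^ v = 0 := by
      rw [add_pow_char_pow, add_pow_char_pow, one_pow, ← pow_mul, ← pow_mul, mul_comm m, h]
    exact pow_eq_zero_iff (by positivity) |>.1 this
  have hm1 : m = 1 := by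
    by_contra hne
    -- the linear coefficient of `(X + 1) ^ m` is `m`, which is odd
    have h2 := congrArg (fun p => coeff p 1) h1
    simp only [coeff_add, coeff_X_pow, coeff_X_add_one_pow, coeff_one, coeff_zero] at h2
    rw [if_neg (Ne.symm hne), if_neg one_ne_zero, Nat.choose_one_right, zero_add, zero_add,
      CharP.cast_eq_zero_iff K 2] at h2
    exact (Nat.not_even_iff_odd.2 hm) (even_iff_two_dvd.2 h2)
  rw [hm1, mul_one]

end PhiPlane

/-! ### Factorizations with a gap below the leading form -/

theorem coeff_mul_eq_of_gap {R : Type*} [CommSemiring R] {p q : R[X]} {i : ℕ} (hi : 0 < i)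
    (hp : ∀ j, 0 < j → j < i → p.coeff j = 0) :
    (p * q).coeff i = p.coeff 0 * q.coeff i + p.coeff i * q.coeff 0 := by
  rw [coeff_mul, Finset.sum_eq_add (0, i) (i, 0)]
  · simp [hi.ne]
  · rintro ⟨a, b⟩ hab ⟨h1, h2⟩
    rw [Finset.HasAntidiagonal.mem_antidiagonal] at hab
    simp only [ne_eq, Prod.mk.injEq, not_and] at h1 h2 hab
    rw [hp a (by grind) (by grind), zero_mul]
  · simp
  · simp

/-- Suppose the coefficients of `p` and `q` have the degrees they have for the reversed plane
restriction of a polynomial, and suppose that the leading forms `p.coeff 0` and `q.coeff 0` are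
coprime. Then a gap below the leading form of `p * q` forces the same gap in `p` and in `q`. -/
theorem gap_of_mul_gap {K : Type*} [Field K] {p q : K[X][X]} {e : ℕ}
    (hp : ∀ i, p.coeff i ≠ 0 → (p.coeff i).natDegree + i ≤ (p.coeff 0).natDegree)
    (hq : ∀ i, q.coeff i ≠ 0 → (q.coeff i).natDegree + i ≤ (q.coeff 0).natDegree)
    (hpq : IsCoprime (p.coeff 0) (q.coeff 0))
    (hgap : ∀ i, 0 < i → i < e → (p * q).coeff i = 0) (i : ℕ) (hi : 0 < i) (hie : i < e) :
    p.coeff i = 0 ∧ q.coeff i = 0 := by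
  induction i using Nat.strong_induction_on with
  | _ i ih =>
    have h := coeff_mul_eq_of_gap (q := q) hi fun j hj hji => (ih j hji hj (hji.trans hie)).1
    rw [hgap i hi hie] at h
    -- each leading form divides the coefficient below it, which has smaller degree
    constructor
    · by_contra hne
      have hdvd : p.coeff 0 ∣ p.coeff i * q.coeff 0 :=
        ⟨-q.coeff i, by linear_combination -h⟩
      have := natDegree_le_of_dvd (hpq.dvd_of_dvd_mul_right hdvd) hne
      have := hp i hne
      omega
    · by_contra hne
      have hdvd : q.coeff 0 ∣ q.coeff i * p.coeff 0 :=
        ⟨-p.coeff i, by linear_combination -h⟩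
      have := natDegree_le_of_dvd (hpq.symm.dvd_of_dvd_mul_right hdvd) hne
      have := hq i hne
      omega

theorem natDegree_coeff_reverse_add_le {R : Type*} [CommRing R] {p : R[X][X]}
    (hp : ∀ i, (p.coeff i).natDegree ≤ i) {i : ℕ} (hi : p.reverse.coeff i ≠ 0) :
    (p.reverse.coeff i).natDegree + i ≤ p.natDegree := by
  have hle : i ≤ p.natDegree :=
    (le_natDegree_of_ne_zero hi).trans (reverse_natDegree_le p)
  rw [coeff_reverse, revAt_le hle] at hi ⊢
  have := hp (p.natDegree - i)
  omega

/-- A common fixed point of the maps `x ↦ x ^ (2 ^ k)` and `x ↦ x ^ (2 ^ (k - 2))`, `k` odd, lies in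
the prime field `𝔽₂`. The second condition is stated in its squared form. -/
theorem sq_eq_self_of_pow_eq {K : Type*} [Field K] {k : ℕ} (hk : Odd k) {α : K} (h1 : α ^ 2 ^ k = α)
    (h2 : α ^ 2 ^ (k - 1) = α ^ 2) : α ^ 2 = α := by
  obtain ⟨l, rfl⟩ := hk
  have h4 : α ^ 4 = α := by
    calc α ^ 4 = (α ^ 2 ^ (2 * l + 1 - 1)) ^ 2 := by rw [h2]; ring
      _ = α := by rw [← pow_mul, ← pow_succ, Nat.add_sub_cancel, h1]
  rw [← h2, Nat.add_sub_cancel, pow_mul]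
  clear h1 h2
  induction l with
  | zero => simp
  | succ l ih => rw [pow_succ, pow_mul, ih]; exact h4

section CharTwo

variable {K : Type*} [Field K] [CharP K 2]

theorem X_pow_add_one_add_pow_gold (k : ℕ) :
    (X ^ (2 ^ k + 1) + 1 + (X + 1) ^ (2 ^ k + 1) : K[X]) = X ^ 2 ^ k + X := by
  have h2 : (2 : K[X]) = 0 := CharTwo.two_eq_zero
  rw [pow_succ (X + 1), add_pow_char_pow, one_pow]
  linear_combination (X ^ (2 ^ k + 1) + 1) * h2

theorem X_pow_add_one_add_pow_boundary (k : ℕ) :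
    (X ^ (2 ^ k + 2) + 1 + (X + 1) ^ (2 ^ k + 2) : K[X]) = X ^ 2 ^ k + X ^ 2 := by
  have h2 : (2 : K[X]) = 0 := CharTwo.two_eq_zero
  rw [pow_add (X + 1), add_pow_char_pow, one_pow]
  linear_combination (X ^ (2 ^ k + 2) + 1 + X ^ 2 ^ k * X + X) * h2

theorem separable_X_pow_add_X {k : ℕ} (hk : k ≠ 0) : (X ^ 2 ^ k + X : K[X]).Separable := by
  have h2 : (2 : K[X]) = 0 := CharTwo.two_eq_zero
  have h : derivative (X ^ 2 ^ k + X : K[X]) = 1 := by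
    have hz : ((2 ^ k : ℕ) : K) = 0 := by
      rw [CharP.cast_eq_zero_iff K 2]
      exact dvd_pow_self 2 hk
    rw [derivative_add, derivative_X_pow, derivative_X, hz]
    simp
  rw [separable_def, h]
  exact isCoprime_one_right

end CharTwo

/-! ### The two leading forms -/

section Lowest

variable {K : Type*} [Field K]

theorem X_sq_add_X_ne_zero : (X ^ 2 + X : K[X]) ≠ 0 := by
  intro h
  simpa [coeff_X, coeff_X_pow] using congrArg (fun p => coeff p 1) h

theorem natDegree_X_sq_add_X : (X ^ 2 + X : K[X]).natDegree = 2 := by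
  compute_degree!

theorem coeff_one_X_sq_add_X_mul (r : K[X]) : ((X ^ 2 + X) * r).coeff 1 = r.coeff 0 := by
  rw [show (X ^ 2 + X) * r = r * X * X + r * X by ring, coeff_add, coeff_mul_X, coeff_mul_X,
    coeff_mul_X_zero, zero_add]

theorem coeff_two_X_sq_add_X_mul (r : K[X]) :
    ((X ^ 2 + X) * r).coeff 2 = r.coeff 0 + r.coeff 1 := by
  rw [show (X ^ 2 + X) * r = r * X * X + r * X by ring, coeff_add, coeff_mul_X, coeff_mul_X,
    coeff_mul_X]

theorem natDegree_add_natDegree_of_mul_eq {k e : ℕ} (he : 2 ^ k = 2 * e + 2) {A B : K[X]}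
    (h : (X ^ 2 + X) * (A * B) = X ^ 2 ^ k + X) : A.natDegree + B.natDegree = 2 * e := by
  have hr : (X ^ 2 ^ k + X : K[X]).natDegree = 2 ^ k := by
    have hlt : 1 < 2 ^ k := by omega
    rw [natDegree_add_eq_left_of_natDegree_lt] <;> rw [natDegree_X_pow]
    rwa [natDegree_X]
  have hne : A * B ≠ 0 := by
    intro h0
    rw [← h, h0, mul_zero, natDegree_zero] at hr
    omega
  have hd := congrArg natDegree h
  rw [natDegree_mul X_sq_add_X_ne_zero hne,
    natDegree_mul (left_ne_zero_of_mul hne) (right_ne_zero_of_mul hne), natDegree_X_sq_add_X,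
    hr] at hd
  omega

/-- If the leading forms `P`, `Q` of two factors satisfy `P Q = φ_d` and `v P + u Q = a φ_m`, with
constant terms `u`, `v`, then `u v = a ^ 2`: it is enough to compare the terms of degree `0` and `1`
in `A`. -/
theorem mul_eq_sq_of_lowest_coeffs [CharP K 2] {P Q : K[X]} {u v a : K} {N M : ℕ} (hN : 2 < N)
    (hM : 2 < M) (h1 : (X ^ 2 + X) * (P * Q) = X ^ N + X)
    (h2 : (X ^ 2 + X) * (P * C v + C u * Q) = C a * (X ^ M + X ^ 2)) : u * v = a ^ 2 := by
  have hN1 : 1 ≠ N := by omega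
  have hM1 : 1 ≠ M := by omega
  have e1 := congrArg (fun r => coeff r 1) h1
  have e2 := congrArg (fun r => coeff r 2) h1
  have e3 := congrArg (fun r => coeff r 1) h2
  have e4 := congrArg (fun r => coeff r 2) h2
  have hPQ : (P * Q).coeff 1 = P.coeff 0 * Q.coeff 1 + P.coeff 1 * Q.coeff 0 :=
    coeff_mul_eq_of_gap one_pos (by omega)
  simp only [coeff_one_X_sq_add_X_mul, coeff_two_X_sq_add_X_mul, hPQ, mul_coeff_zero, coeff_add,
    coeff_mul_C, coeff_C_mul, coeff_C_zero, coeff_X_pow, coeff_X, hN1, hM1, hN.ne, hM.ne,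
    if_true, if_false, OfNat.one_ne_ofNat] at e1 e2 e3 e4
  norm_num at e1 e2 e3 e4
  have h0 : (2 : K) = 0 := CharTwo.two_eq_zero
  have hu : u = v * P.coeff 0 ^ 2 := by
    linear_combination (-u) * e1 + P.coeff 0 * e3 - v * P.coeff 0 ^ 2 * h0
  have ha : a = v * P.coeff 0 := by
    linear_combination e3 - e4 + Q.coeff 1 * hu - (P.coeff 1 * v + v * P.coeff 0) * e1 +
      v * P.coeff 0 * e2 - v * P.coeff 0 * h0
  rw [ha, hu]
  ring

end Lowest

section Boundary

variable {K : Type*} [Field K] [CharP K 2]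

theorem leadingForm_of_coeff {k e : ℕ} (he : 2 ^ k = 2 * e + 2) {f : K[X]}
    (hf1 : f.coeff (2 * e + 3) = 1) (hf0 : ∀ j, e + 3 < j → j ≠ 2 * e + 3 → f.coeff j = 0)
    {r : K[X][X]} (hr : ∀ i, (X ^ 2 + X) * r.coeff i =
      C (f.coeff (i + 3)) * (X ^ (i + 3) + 1 + (X + 1) ^ (i + 3))) :
    r.natDegree = 2 * e ∧ (X ^ 2 + X) * r.leadingCoeff = X ^ 2 ^ k + X := by
  have htop : (X ^ 2 + X) * r.coeff (2 * e) = X ^ 2 ^ k + X := by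
    rw [hr, hf1, C_1, one_mul, show 2 * e + 3 = 2 ^ k + 1 by omega,
      X_pow_add_one_add_pow_gold]
  have hdeg : r.natDegree = 2 * e := by
    apply le_antisymm
    · refine natDegree_le_iff_coeff_eq_zero.2 fun i hi => ?_
      have h := hr i
      rw [hf0 _ (by omega) (by omega), C_0, zero_mul] at h
      exact (mul_eq_zero.1 h).resolve_left X_sq_add_X_ne_zero
    · apply le_natDegree_of_ne_zero
      intro h
      rw [h, mul_zero] at htop
      have := congrArg (fun p => coeff p 1) htop
      have h2k : (1 : ℕ) ≠ 2 ^ k := by omega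
      simp [coeff_X_pow, h2k] at this
  exact ⟨hdeg, by rw [leadingCoeff, hdeg, htop]⟩

/-- If the restricted `phi f` is a product of two polynomials of positive degree, subject to the
degree bounds that plane restrictions satisfy, then both have degree `e`, and the coefficients of
`f` are those of the boundary form. Here `2 * e + 3 = 2 ^ k + 1` and `e + 3 = 2 ^ (k - 1) + 2`. -/
theorem boundary_of_mul [IsAlgClosed K] {k e : ℕ} (hk : Odd k) (hk1 : 1 < k)
    (he : 2 ^ k = 2 * e + 2) {f : K[X]} (hf1 : f.coeff (2 * e + 3) = 1)
    (hf0 : ∀ j, e + 3 < j → j ≠ 2 * e + 3 → f.coeff j = 0) (hfm : f.coeff (e + 3) ≠ 0)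
    {p q : K[X][X]} (hp : ∀ i, (p.coeff i).natDegree ≤ i) (hq : ∀ i, (q.coeff i).natDegree ≤ i)
    (hp0 : p.natDegree ≠ 0) (hq0 : q.natDegree ≠ 0)
    (hpq : ∀ i, (X ^ 2 + X) * (p * q).coeff i =
      C (f.coeff (i + 3)) * (X ^ (i + 3) + 1 + (X + 1) ^ (i + 3))) :
    p.natDegree = e ∧ q.natDegree = e ∧ f.coeff 3 = f.coeff (e + 3) ^ 2 ∧
      ∀ j, 3 < j → j < e + 3 → f.coeff j ≠ 0 → ∃ i : ℕ, j = 2 ^ i := by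
  obtain ⟨hdeg, hlead⟩ := leadingForm_of_coeff he hf1 hf0 hpq
  have hk3 : 3 ≤ k := by
    obtain ⟨l, rfl⟩ := hk
    omega
  have he' : 2 ^ (k - 1) = e + 1 := by
    have : 2 ^ k = 2 * 2 ^ (k - 1) := by
      rw [← pow_succ']
      congr 1
      omega
    omega
  have he3 : 3 ≤ e := by
    have : 2 ^ 2 ≤ 2 ^ (k - 1) := Nat.pow_le_pow_right (by norm_num) (by omega)
    omega
  have hpne : p ≠ 0 := by
    rintro rfl
    simp at hp0
  have hqne : q ≠ 0 := by
    rintro rfl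
    simp at hq0
  rw [natDegree_mul hpne hqne] at hdeg
  rw [leadingCoeff_mul] at hlead
  have hrev : (p * q).reverse = p.reverse * q.reverse := reverse_mul_of_domain p q
  have hrevcoeff : ∀ i ≤ 2 * e, (p.reverse * q.reverse).coeff i = (p * q).coeff (2 * e - i) := by
    intro i hi
    rw [← hrev, coeff_reverse, natDegree_mul hpne hqne, hdeg, revAt_le hi]
  -- the leading forms attain the largest possible degrees
  have hsum : p.leadingCoeff.natDegree + q.leadingCoeff.natDegree = 2 * e :=
    natDegree_add_natDegree_of_mul_eq he hlead
  have hpd : p.leadingCoeff.natDegree = p.natDegree := by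
    have h1 : p.leadingCoeff.natDegree ≤ p.natDegree := hp _
    have h2 : q.leadingCoeff.natDegree ≤ q.natDegree := hq _
    omega
  have hqd : q.leadingCoeff.natDegree = q.natDegree := by omega
  have hsep := separable_X_pow_add_X (K := K) (k := k) (by omega)
  rw [← hlead] at hsep
  have hcop : IsCoprime p.leadingCoeff q.leadingCoeff := hsep.of_mul_right.isCoprime
  have hpr : ∀ i, p.reverse.coeff i ≠ 0 → (p.reverse.coeff i).natDegree + i ≤ p.natDegree :=
    fun i hi => natDegree_coeff_reverse_add_le hp hi
  have hqr : ∀ i, q.reverse.coeff i ≠ 0 → (q.reverse.coeff i).natDegree + i ≤ q.natDegree :=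
    fun i hi => natDegree_coeff_reverse_add_le hq hi
  have hgap : ∀ i, 0 < i → i < e → p.reverse.coeff i = 0 ∧ q.reverse.coeff i = 0 := by
    apply gap_of_mul_gap
    · simpa only [coeff_zero_reverse, hpd] using hpr
    · simpa only [coeff_zero_reverse, hqd] using hqr
    · simpa only [coeff_zero_reverse] using hcop
    · intro i hi hie
      have h := hpq (2 * e - i)
      rw [hf0 _ (by omega) (by omega), C_0, zero_mul] at h
      rw [hrevcoeff i (by omega)]
      exact (mul_eq_zero.1 h).resolve_left X_sq_add_X_ne_zero
  -- the coefficient of degree `e` below the top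
  have hmid : (X ^ 2 + X) * (p.leadingCoeff * q.reverse.coeff e +
      p.reverse.coeff e * q.leadingCoeff) =
      C (f.coeff (e + 3)) * (X ^ 2 ^ (k - 1) + X ^ 2) := by
    have h := hpq e
    rw [show e = 2 * e - e by omega, ← hrevcoeff e (by omega),
      coeff_mul_eq_of_gap (by omega) fun j h1 h2 => (hgap j h1 h2).1, coeff_zero_reverse,
      coeff_zero_reverse, show 2 * e - e + 3 = 2 ^ (k - 1) + 2 by omega,
      X_pow_add_one_add_pow_boundary] at h
    rw [h, show 2 ^ (k - 1) + 2 = e + 3 by omega]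
  have hroot : ∀ α : K, (p.leadingCoeff * q.leadingCoeff).eval α = 0 →
      (p.leadingCoeff * q.reverse.coeff e + p.reverse.coeff e * q.leadingCoeff).eval α ≠ 0 := by
    intro α h1 h2
    have h3 := congrArg (eval α) hlead
    have h4 := congrArg (eval α) hmid
    rw [eval_mul, h1, mul_zero] at h3
    rw [eval_mul, h2, mul_zero] at h4
    simp only [eval_add, eval_pow, eval_X, eval_mul, eval_C] at h3 h4
    have h5 : α ^ 2 = α := sq_eq_self_of_pow_eq hk (CharTwo.add_eq_zero.1 h3.symm)
      (CharTwo.add_eq_zero.1 ((mul_eq_zero.1 h4.symm).resolve_left hfm))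
    -- `α` would be a double root of `X ^ 2 ^ k + X`
    obtain ⟨u, v, huv⟩ := hsep.isCoprime
    have h6 := congrArg (eval α) huv
    rw [eval_add, eval_mul, eval_mul, h1] at h6
    simp [h5, CharTwo.add_self_eq_zero] at h6
  -- a factor of degree less than `e` would divide both forms `φ_d` and `φ_m`
  have hq_ge : e ≤ q.natDegree := by
    by_contra hlt
    obtain ⟨α, hα⟩ := IsAlgClosed.exists_root q.leadingCoeff
      (fun h => hq0 (by rw [← hqd, natDegree_eq_zero_iff_degree_le_zero.2 h.le]))
    have hz : q.reverse.coeff e = 0 := by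
      by_contra hne
      have := hqr e hne
      omega
    rw [IsRoot] at hα
    exact hroot α (by simp [hα]) (by simp [hα, hz])
  have hp_ge : e ≤ p.natDegree := by
    by_contra hlt
    obtain ⟨α, hα⟩ := IsAlgClosed.exists_root p.leadingCoeff
      (fun h => hp0 (by rw [← hpd, natDegree_eq_zero_iff_degree_le_zero.2 h.le]))
    have hz : p.reverse.coeff e = 0 := by
      by_contra hne
      have := hpr e hne
      omega
    rw [IsRoot] at hα
    exact hroot α (by simp [hα]) (by simp [hα, hz])
  have hpe : p.natDegree = e := by omega
  have hqe : q.natDegree = e := by omega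
  refine ⟨hpe, hqe, ?_, ?_⟩
  · obtain ⟨u, hu⟩ : ∃ u, p.coeff 0 = C u := ⟨_, eq_C_of_natDegree_le_zero (hp 0)⟩
    obtain ⟨v, hv⟩ : ∃ v, q.coeff 0 = C v := ⟨_, eq_C_of_natDegree_le_zero (hq 0)⟩
    have h3 : u * v = f.coeff 3 := by
      have h := hpq 0
      rw [mul_coeff_zero, hu, hv, ← C_mul, zero_add,
        show (X ^ 3 + 1 + (X + 1) ^ 3 : K[X]) = X ^ 2 + X by
          have h2 : (2 : K[X]) = 0 := CharTwo.two_eq_zero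
          linear_combination (X ^ 3 + 1 + X ^ 2 + X) * h2, mul_comm] at h
      exact C_injective (mul_right_cancel₀ X_sq_add_X_ne_zero h)
    rw [coeff_reverse, coeff_reverse, hpe, hqe, revAt_le le_rfl, Nat.sub_self, hu, hv] at hmid
    rw [← h3]
    exact mul_eq_sq_of_lowest_coeffs (by omega) (by omega) hlead hmid
  · intro j hj1 hj2 hne
    have h := hpq (j - 3)
    have hz : (p * q).coeff (j - 3) = 0 := by
      have h1 := hrevcoeff (2 * e - (j - 3)) (by omega)
      rw [show 2 * e - (2 * e - (j - 3)) = j - 3 by omega] at h1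
      rw [← h1, coeff_mul]
      refine Finset.sum_eq_zero fun ab hab => ?_
      rw [Finset.HasAntidiagonal.mem_antidiagonal] at hab
      -- the reversed factors only have coefficients at `0` and at `e`
      have hp' : ab.1 ≠ 0 → ab.1 ≠ e → p.reverse.coeff ab.1 = 0 := by
        intro h0 h1
        rcases lt_or_ge ab.1 e with h | h
        · exact (hgap _ (by omega) h).1
        · by_contra hne
          have := hpr _ hne
          omega
      have hq' : ab.2 ≠ 0 → ab.2 ≠ e → q.reverse.coeff ab.2 = 0 := by
        intro h0 h1
        rcases lt_or_ge ab.2 e with h | h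
        · exact (hgap _ (by omega) h).2
        · by_contra hne
          have := hqr _ hne
          omega
      by_cases h0 : ab.1 = 0 ∨ ab.1 = e
      · rw [hq' (by omega) (by omega), mul_zero]
      · rw [hp' (by omega) (by omega), zero_mul]
    rw [hz, mul_zero, show j - 3 + 3 = j by omega] at h
    exact eq_two_pow_of_X_pow_additive (K := K) (by omega)
      ((mul_eq_zero.1 h.symm).resolve_left (by simpa using hne))

end Boundary

/-! ### Factorizations of `phi` over an algebraically closed field -/

theorem MvPolynomial.totalDegree_ne_zero_of_not_isUnit {σ K : Type*} [Field K]
    {P : MvPolynomial σ K} (h0 : P ≠ 0) (h : ¬ IsUnit P) : P.totalDegree ≠ 0 := by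
  intro hd
  refine h (MvPolynomial.isUnit_iff_totalDegree_of_isReduced.2 ⟨IsUnit.mk0 _ fun hc => h0 ?_, hd⟩)
  rw [MvPolynomial.totalDegree_eq_zero_iff_eq_C.1 hd, hc, map_zero]

section Factorization

variable {K : Type*} [Field K] [CharP K 2] {k e : ℕ} {f : K[X]}

theorem planeRestriction_phi_spec (he : 2 ^ k = 2 * e + 2) (hf1 : f.coeff (2 * e + 3) = 1)
    (hf0 : ∀ j, e + 3 < j → j ≠ 2 * e + 3 → f.coeff j = 0) :
    (planeRestriction K (phi f)).natDegree = 2 * e ∧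
      (X ^ 2 + X) * (planeRestriction K (phi f)).leadingCoeff = X ^ 2 ^ k + X :=
  leadingForm_of_coeff he hf1 hf0 (coeff_planeRestriction_phi f)

theorem totalDegree_phi (he : 2 ^ k = 2 * e + 2) (hf1 : f.coeff (2 * e + 3) = 1)
    (hf0 : ∀ j, e + 3 < j → j ≠ 2 * e + 3 → f.coeff j = 0) : (phi f).totalDegree = 2 * e := by
  have hf : f.natDegree ≤ 2 * e + 3 :=
    natDegree_le_iff_coeff_eq_zero.2 fun j hj => hf0 j (by omega) (by omega)
  have h1 := totalDegree_phi_add_three_le f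
  have h2 := natDegree_planeRestriction_le (phi f)
  rw [(planeRestriction_phi_spec he hf1 hf0).1] at h2
  omega

theorem natDegree_planeRestriction_factor (he : 2 ^ k = 2 * e + 2)
    (hf1 : f.coeff (2 * e + 3) = 1) (hf0 : ∀ j, e + 3 < j → j ≠ 2 * e + 3 → f.coeff j = 0)
    (hphi : phi f ≠ 0) {P Q : MvPolynomial (Fin 3) K} (h : phi f = P * Q) :
    (planeRestriction K P).natDegree = P.totalDegree ∧
      (planeRestriction K Q).natDegree = Q.totalDegree := by
  have hP : P ≠ 0 := left_ne_zero_of_mul (h ▸ hphi)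
  have hQ : Q ≠ 0 := right_ne_zero_of_mul (h ▸ hphi)
  have h1 := totalDegree_phi he hf1 hf0
  obtain ⟨h2, h3⟩ := planeRestriction_phi_spec he hf1 hf0
  have hne : planeRestriction K (phi f) ≠ 0 := by
    intro h0
    rw [h0, leadingCoeff_zero, mul_zero] at h3
    have := congrArg (fun p => coeff p 1) h3
    have h2k : (1 : ℕ) ≠ 2 ^ k := by omega
    simp [coeff_X_pow, h2k] at this
  rw [h, map_mul] at h2 hne
  rw [natDegree_mul (left_ne_zero_of_mul hne) (right_ne_zero_of_mul hne)] at h2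
  rw [h, MvPolynomial.totalDegree_mul_of_isDomain hP hQ] at h1
  have := natDegree_planeRestriction_le P
  have := natDegree_planeRestriction_le Q
  omega

theorem boundary_of_phi_eq_mul [IsAlgClosed K] (hk : Odd k) (hk1 : 1 < k)
    (he : 2 ^ k = 2 * e + 2) (hf1 : f.coeff (2 * e + 3) = 1)
    (hf0 : ∀ j, e + 3 < j → j ≠ 2 * e + 3 → f.coeff j = 0) (hfm : f.coeff (e + 3) ≠ 0)
    (hphi : phi f ≠ 0) {P Q : MvPolynomial (Fin 3) K} (h : phi f = P * Q)
    (hP : ¬ IsUnit P) (hQ : ¬ IsUnit Q) :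
    P.totalDegree = e ∧ Q.totalDegree = e ∧ f.coeff 3 = f.coeff (e + 3) ^ 2 ∧
      ∀ j, 3 < j → j < e + 3 → f.coeff j ≠ 0 → ∃ i : ℕ, j = 2 ^ i := by
  obtain ⟨hdP, hdQ⟩ := natDegree_planeRestriction_factor he hf1 hf0 hphi h
  have hP0 := MvPolynomial.totalDegree_ne_zero_of_not_isUnit (left_ne_zero_of_mul (h ▸ hphi)) hP
  have hQ0 := MvPolynomial.totalDegree_ne_zero_of_not_isUnit (right_ne_zero_of_mul (h ▸ hphi)) hQ
  rw [← hdP] at hP0 ⊢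
  rw [← hdQ] at hQ0 ⊢
  refine boundary_of_mul hk hk1 he hf1 hf0 hfm (natDegree_coeff_planeRestriction_le P)
    (natDegree_coeff_planeRestriction_le Q) hP0 hQ0 fun i => ?_
  rw [← map_mul, ← h, coeff_planeRestriction_phi]

/-- As every proper factor of `phi f` has half the degree, it is irreducible. -/
theorem irreducible_of_phi_eq_mul [IsAlgClosed K] (hk : Odd k) (hk1 : 1 < k)
    (he : 2 ^ k = 2 * e + 2) (hf1 : f.coeff (2 * e + 3) = 1)
    (hf0 : ∀ j, e + 3 < j → j ≠ 2 * e + 3 → f.coeff j = 0) (hfm : f.coeff (e + 3) ≠ 0)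
    (hphi : phi f ≠ 0) {P Q : MvPolynomial (Fin 3) K} (h : phi f = P * Q)
    (hP : ¬ IsUnit P) (hQ : ¬ IsUnit Q) : Irreducible P := by
  refine ⟨hP, fun U V hUV => ?_⟩
  by_contra! hu
  subst hUV
  have hne : U * V * Q ≠ 0 := h ▸ hphi
  have hV : V ≠ 0 := right_ne_zero_of_mul (left_ne_zero_of_mul hne)
  have hQ' : Q ≠ 0 := right_ne_zero_of_mul hne
  have h1 := (boundary_of_phi_eq_mul hk hk1 he hf1 hf0 hfm hphi h hP hQ).2.1
  have h2 := (boundary_of_phi_eq_mul hk hk1 he hf1 hf0 hfm hphi (h.trans (mul_assoc U V Q)) hu.1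
    (fun hVQ => hQ (isUnit_of_mul_isUnit_right hVQ))).2.1
  rw [MvPolynomial.totalDegree_mul_of_isDomain hV hQ', h1] at h2
  have := MvPolynomial.totalDegree_ne_zero_of_not_isUnit hV hu.2
  omega

end Factorization

/-! ### Descent to the finite field -/

theorem mem_range_algebraMap_of_pow_card_eq {F L : Type*} [Field F] [Fintype F] [Field L]
    [Algebra F L] {x : L} (hx : x ^ Fintype.card F = x) : x ∈ Set.range (algebraMap F L) := by
  have hdeg := FiniteField.X_pow_card_sub_X_natDegree_eq F (Fintype.one_lt_card (α := F))
  have hmonic : (X ^ Fintype.card F - X : F[X]).Monic :=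
    monic_X_pow_sub (degree_X_le.trans_lt (by exact_mod_cast Fintype.one_lt_card (α := F)))
  have hprod := prod_multiset_X_sub_C_of_monic_of_roots_card_eq hmonic (by
    rw [hdeg, FiniteField.roots_X_pow_card_sub_X F, Finset.card_val, Finset.card_univ])
  rw [FiniteField.roots_X_pow_card_sub_X F] at hprod
  have h := congrArg (aeval x) hprod
  rw [map_sub, map_pow, aeval_X, hx, sub_self, map_multiset_prod, Multiset.prod_eq_zero_iff] at h
  simp only [Multiset.mem_map, exists_exists_and_eq_and, map_sub, aeval_X, aeval_C] at h
  obtain ⟨a, -, ha⟩ := h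
  exact ⟨a, (sub_eq_zero.1 ha).symm⟩

theorem MvPolynomial.mem_range_map_of_map_frobenius_eq {σ F L : Type*} [Field F] [Fintype F]
    [Field L] [Algebra F L] {τ : L →+* L} (hτ : ∀ x, τ x = x ^ Fintype.card F)
    {P : MvPolynomial σ L} (hP : MvPolynomial.map τ P = P) :
    ∃ P₀ : MvPolynomial σ F, MvPolynomial.map (algebraMap F L) P₀ = P := by
  rw [← Set.mem_range, MvPolynomial.mem_range_map_iff_coeffs_subset]
  intro c hc
  obtain ⟨m, -, rfl⟩ := MvPolynomial.mem_coeffs_iff.1 hc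
  apply mem_range_algebraMap_of_pow_card_eq
  rw [← hτ, ← MvPolynomial.coeff_map, hP]

/-- A polynomial that Frobenius maps to an associate of itself becomes a polynomial over the
finite field after a rescaling. -/
theorem MvPolynomial.exists_map_eq_C_mul_of_associated {σ F L : Type*} [Field F] [Fintype F]
    [Field L] [Algebra F L] {τ : L →+* L} (hτ : ∀ x, τ x = x ^ Fintype.card F)
    {P : MvPolynomial σ L} (hP0 : P ≠ 0) (hP : Associated (MvPolynomial.map τ P) P) :
    ∃ c : L, c ≠ 0 ∧ ∃ P₀ : MvPolynomial σ F,
      MvPolynomial.map (algebraMap F L) P₀ = MvPolynomial.C c * P := by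
  obtain ⟨m, hm⟩ := MvPolynomial.ne_zero_iff.1 hP0
  refine ⟨(P.coeff m)⁻¹, inv_ne_zero hm, MvPolynomial.mem_range_map_of_map_frobenius_eq hτ ?_⟩
  obtain ⟨u, hu⟩ := hP
  obtain ⟨r, -, hr⟩ := MvPolynomial.isUnit_iff_eq_C_of_isReduced.1 u.isUnit
  -- comparing the coefficients at `m` identifies the constant `r`
  rw [hr] at hu
  have hum := congrArg (MvPolynomial.coeff m) hu
  rw [mul_comm, MvPolynomial.coeff_C_mul, MvPolynomial.coeff_map] at hum
  have hτm : τ (P.coeff m) ≠ 0 := (map_ne_zero τ).2 hm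
  have hc : (τ (P.coeff m))⁻¹ = (P.coeff m)⁻¹ * r := by
    field_simp
    linear_combination -hum
  rw [map_mul, MvPolynomial.map_C, map_inv₀, hc, MvPolynomial.C_mul, mul_assoc,
    mul_comm (MvPolynomial.C r), hu]

/-- Frobenius cannot exchange two coprime sets of roots that lie in a field of odd degree `k`
over `𝔽₂`: its `k`-th power, which fixes these roots, would exchange them too. -/
theorem not_frobenius_swap {K : Type*} [Field K] [CharP K 2] [IsAlgClosed K] {k n : ℕ}
    (hk : Odd k) {A B : K[X]} (hA : A.natDegree ≠ 0)
    (hAB : (X ^ 2 + X) * (A * B) = X ^ 2 ^ k + X)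
    (h1 : ∀ x, A.IsRoot x → B.IsRoot (x ^ 2 ^ n)) (h2 : ∀ x, B.IsRoot x → A.IsRoot (x ^ 2 ^ n)) :
    False := by
  obtain ⟨α, hα⟩ := IsAlgClosed.exists_root A
    (fun h => hA (natDegree_eq_zero_iff_degree_le_zero.2 h.le))
  have hfix : α ^ 2 ^ k = α := by
    have h := congrArg (eval α) hAB
    rw [eval_mul, eval_mul, hα.eq_zero, zero_mul, mul_zero] at h
    simp only [eval_add, eval_pow, eval_X] at h
    exact CharTwo.add_eq_zero.1 h.symm
  have hfixn : ∀ n, α ^ (2 ^ k) ^ n = α := by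
    intro n
    induction n with
    | zero => simp
    | succ n ih => rw [pow_succ, pow_mul, ih, hfix]
  have hiter : ∀ l, A.IsRoot (α ^ (2 ^ n) ^ (2 * l)) := by
    intro l
    induction l with
    | zero => simpa using hα
    | succ l ih =>
      have h := h2 _ (h1 _ ih)
      rwa [← pow_mul, ← pow_mul, ← pow_two (2 ^ n), ← pow_add] at h
  have hB : B.IsRoot α := by
    obtain ⟨l, hl⟩ := hk
    have h := h1 _ (hiter l)
    rwa [← pow_mul, ← pow_succ, ← hl, ← pow_mul, mul_comm n, pow_mul, hfixn] at h
  have hsep := separable_X_pow_add_X (K := K) hk.pos.ne'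
  rw [← hAB] at hsep
  obtain ⟨u, v, huv⟩ := hsep.of_mul_right.isCoprime
  have h := congrArg (eval α) huv
  rw [eval_add, eval_mul, eval_mul, hα.eq_zero, hB.eq_zero] at h
  simp at h

theorem isRoot_leadingCoeff_of_associated_map {K : Type*} [Field K] {τ : K →+* K}
    {P Q : MvPolynomial (Fin 3) K} (h : Associated (MvPolynomial.map τ P) Q) {x : K}
    (hx : (planeRestriction K P).leadingCoeff.IsRoot x) :
    (planeRestriction K Q).leadingCoeff.IsRoot (τ x) := by
  obtain ⟨u, rfl⟩ := h
  have hinj : Function.Injective (mapRingHom τ) := map_injective τ τ.injective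
  rw [map_mul, leadingCoeff_mul, planeRestriction_map, leadingCoeff_map_of_injective hinj, IsRoot,
    eval_mul, coe_mapRingHom, eval_map_apply, hx.eq_zero, map_zero, zero_mul]

/-- A factorization of `phi f` over the algebraic closure into two proper factors can be rescaled
to one over the finite field `F`. -/
theorem exists_factorization_of_map_phi_eq_mul {F : Type*} [Field F] [Finite F] [CharP F 2]
    {n k e : ℕ} (hF : Nat.card F = 2 ^ n) (hk : Odd k) (hk1 : 1 < k) (he : 2 ^ k = 2 * e + 2)
    {f : F[X]} (hf1 : f.coeff (2 * e + 3) = 1)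
    (hf0 : ∀ j, e + 3 < j → j ≠ 2 * e + 3 → f.coeff j = 0) (hfm : f.coeff (e + 3) ≠ 0)
    {P Q : MvPolynomial (Fin 3) (AlgebraicClosure F)}
    (h : MvPolynomial.map (algebraMap F (AlgebraicClosure F)) (phi f) = P * Q)
    (hP : ¬ IsUnit P) (hQ : ¬ IsUnit Q) :
    ∃ P₀ Q₀ : MvPolynomial (Fin 3) F,
      AbsolutelyIrreducible P₀ ∧ AbsolutelyIrreducible Q₀ ∧ phi f = P₀ * Q₀ := by
  have := Fintype.ofFinite F
  have : CharP (AlgebraicClosure F) 2 := charP_of_injective_algebraMap' F 2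
  let K := AlgebraicClosure F
  let ι : F →+* K := algebraMap F K
  have hf1' : (f.map ι).coeff (2 * e + 3) = 1 := by rw [coeff_map, hf1, map_one]
  have hf0' : ∀ j, e + 3 < j → j ≠ 2 * e + 3 → (f.map ι).coeff j = 0 := fun j h1 h2 => by
    rw [coeff_map, hf0 j h1 h2, map_zero]
  have hfm' : (f.map ι).coeff (e + 3) ≠ 0 := by
    rw [coeff_map]
    exact (map_ne_zero ι).2 hfm
  have hK : phi (f.map ι) = P * Q := by rw [← map_phi, h]
  have he0 : 0 < e := by
    have : 2 ^ 2 ≤ 2 ^ k := Nat.pow_le_pow_right (by norm_num) hk1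
    omega
  have hphi : phi (f.map ι) ≠ 0 := by
    intro h0
    have := totalDegree_phi he hf1' hf0'
    rw [h0, MvPolynomial.totalDegree_zero] at this
    omega
  have hP0 : P ≠ 0 := left_ne_zero_of_mul (hK ▸ hphi)
  have hQ0 : Q ≠ 0 := right_ne_zero_of_mul (hK ▸ hphi)
  have hPirr : Irreducible P :=
    irreducible_of_phi_eq_mul hk hk1 he hf1' hf0' hfm' hphi hK hP hQ
  have hQirr : Irreducible Q :=
    irreducible_of_phi_eq_mul hk hk1 he hf1' hf0' hfm' hphi (hK.trans (mul_comm P Q)) hQ hP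
  let τ : K ≃ₐ[F] K := FiniteField.frobeniusAlgEquivOfAlgebraic F K
  have hτ : ∀ x, (τ : K →+* K) x = x ^ Fintype.card F := fun x => rfl
  have hcard : Fintype.card F = 2 ^ n := by rw [← Nat.card_eq_fintype_card, hF]
  let T : MvPolynomial (Fin 3) K →+* MvPolynomial (Fin 3) K := MvPolynomial.map (τ : K →+* K)
  have hTι : ∀ R : MvPolynomial (Fin 3) F, T (MvPolynomial.map ι R) = MvPolynomial.map ι R := by
    intro R
    have : (τ : K →+* K).comp ι = ι := by
      ext a
      exact τ.commutes a
    simp only [T]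
    rw [MvPolynomial.map_map, this]
  have hTphi : T P * T Q = P * Q := by rw [← map_mul, ← h, hTι]
  have hTP : Irreducible (T P) :=
    (MulEquiv.irreducible_iff (MvPolynomial.mapEquiv (Fin 3) (τ : K ≃+* K))).2 hPirr
  -- Frobenius preserves or exchanges the two factors
  have hassoc : Associated (T P) P := by
    rcases hTP.prime.dvd_or_dvd (Dvd.intro _ hTphi) with hd | hd
    · exact hTP.associated_of_dvd hPirr hd
    · exfalso
      have h1 : Associated (T P) Q := hTP.associated_of_dvd hQirr hd
      have h2 : Associated (T Q) P := by
        obtain ⟨u, hu⟩ := h1.symm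
        refine ⟨u, mul_right_cancel₀ hQ0 ?_⟩
        rw [← hTphi, ← hu]
        ring
      obtain ⟨-, hlead⟩ := planeRestriction_phi_spec he hf1' hf0'
      rw [hK, map_mul, leadingCoeff_mul] at hlead
      have hroot : ∀ x, (τ : K →+* K) x = x ^ 2 ^ n := fun x => by rw [hτ, hcard]
      refine not_frobenius_swap (n := n) hk ?_ hlead
        (fun x hx => hroot x ▸ isRoot_leadingCoeff_of_associated_map h1 hx)
        (fun x hx => hroot x ▸ isRoot_leadingCoeff_of_associated_map h2 hx)
      -- both leading forms have degree `e`, so that of `P` has a root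
      obtain ⟨hdP, hdQ⟩ := natDegree_planeRestriction_factor he hf1' hf0' hphi hK
      obtain ⟨heP, heQ, -⟩ := boundary_of_phi_eq_mul hk hk1 he hf1' hf0' hfm' hphi hK hP hQ
      have hsum := natDegree_add_natDegree_of_mul_eq he hlead
      have hQle : (planeRestriction K Q).leadingCoeff.natDegree ≤ (planeRestriction K Q).natDegree :=
        natDegree_coeff_planeRestriction_le Q _
      omega
  obtain ⟨c, hc, P₀, hP₀⟩ := MvPolynomial.exists_map_eq_C_mul_of_associated hτ hP0 hassoc
  have hcu : IsUnit (MvPolynomial.C c : MvPolynomial (Fin 3) K) :=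
    (IsUnit.mk0 c hc).map MvPolynomial.C
  have hcu' : IsUnit (MvPolynomial.C c⁻¹ : MvPolynomial (Fin 3) K) :=
    (IsUnit.mk0 _ (inv_ne_zero hc)).map MvPolynomial.C
  have hPQ : MvPolynomial.map ι (phi f) = MvPolynomial.map ι P₀ * (MvPolynomial.C c⁻¹ * Q) := by
    rw [hP₀, h, mul_mul_mul_comm, ← MvPolynomial.C_mul, mul_inv_cancel₀ hc, MvPolynomial.C_1,
      one_mul]
  -- the complementary factor is fixed by Frobenius as well
  obtain ⟨Q₀, hQ₀⟩ := MvPolynomial.mem_range_map_of_map_frobenius_eq (F := F) hτ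
    (P := MvPolynomial.C c⁻¹ * Q) (by
      have h1 := congrArg T hPQ
      rw [map_mul, hTι, hTι, hPQ] at h1
      refine (mul_left_cancel₀ ?_ h1).symm
      rw [hP₀]
      exact mul_ne_zero hcu.ne_zero hP0)
  refine ⟨P₀, Q₀, ?_, ?_, ?_⟩
  · rw [AbsolutelyIrreducible, hP₀]
    exact (irreducible_isUnit_mul hcu).2 hPirr
  · rw [AbsolutelyIrreducible, hQ₀]
    exact (irreducible_isUnit_mul hcu').2 hQirr
  · apply MvPolynomial.map_injective ι ι.injective
    rw [map_mul, hPQ, ← hQ₀]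

theorem hasBoundaryForm_of_coeff {F : Type*} [Field F] {k : ℕ} (hk : 2 < k) {g : F[X]}
    (h3 : g.coeff 3 = g.coeff (2 ^ (k - 1) + 2) ^ 2)
    (hg : ∀ j, 3 < j → j ≠ 2 ^ (k - 1) + 2 → g.coeff j ≠ 0 → ∃ i : ℕ, j = 2 ^ i) :
    HasBoundaryForm k g := by
  refine ⟨g.coeff (2 ^ (k - 1) + 2), g - C (g.coeff (2 ^ (k - 1) + 2)) * X ^ (2 ^ (k - 1) + 2) -
    C (g.coeff (2 ^ (k - 1) + 2) ^ 2) * X ^ 3, ?_, by ring⟩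
  have hm : 2 ^ 2 ≤ 2 ^ (k - 1) := Nat.pow_le_pow_right (by norm_num) (by omega)
  intro j hj
  rw [coeff_sub, coeff_sub, coeff_C_mul_X_pow, coeff_C_mul_X_pow] at hj
  by_cases hjm : j = 2 ^ (k - 1) + 2
  · rw [if_pos hjm, if_neg (by omega), hjm] at hj
    simp at hj
  by_cases hj3 : j = 3
  · rw [if_neg hjm, if_pos hj3, hj3, h3] at hj
    simp at hj
  rw [if_neg hjm, if_neg hj3, sub_zero, sub_zero] at hj
  rcases Nat.lt_or_ge 3 j with h | h
  · exact Or.inr (hg j h hjm hj)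
  · have hj' : j = 0 ∨ j = 1 ∨ j = 2 := by omega
    rcases hj' with rfl | rfl | rfl
    · exact Or.inl rfl
    · exact Or.inr ⟨0, rfl⟩
    · exact Or.inr ⟨1, rfl⟩

theorem mainTheorem4 {F : Type*} [Field F] [Finite F] [CharP F 2] (n k : ℕ)
    (hF : Nat.card F = 2 ^ n) (hk : Odd k) (hk1 : 1 < k) (hkn : Nat.Coprime k n)
    (g : F[X]) (hg : g.degree = ((2 ^ (k - 1) + 2 : ℕ) : WithBot ℕ)) :
    (¬ HasBoundaryForm k g →
      AbsolutelyIrreducible (phi (X ^ (2 ^ k + 1) + g))) ∧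
    (HasBoundaryForm k g →
      AbsolutelyIrreducible (phi (X ^ (2 ^ k + 1) + g)) ∨
      ∃ P Q : MvPolynomial (Fin 3) F,
        AbsolutelyIrreducible P ∧ AbsolutelyIrreducible Q ∧
          phi (X ^ (2 ^ k + 1) + g) = P * Q) := by
  have hk3 : 2 < k := by
    obtain ⟨l, rfl⟩ := hk
    omega
  have hpow : 2 ^ 2 ≤ 2 ^ (k - 1) := Nat.pow_le_pow_right (by norm_num) (by omega)
  obtain ⟨e, he'⟩ : ∃ e, 2 ^ (k - 1) = e + 1 := ⟨2 ^ (k - 1) - 1, by omega⟩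
  have he : 2 ^ k = 2 * e + 2 := by
    have : 2 ^ k = 2 * 2 ^ (k - 1) := by
      rw [← pow_succ']
      congr 1
      omega
    omega
  have hm : 2 ^ (k - 1) + 2 = e + 3 := by omega
  have hd : 2 ^ k + 1 = 2 * e + 3 := by omega
  have hgdeg : g.natDegree = e + 3 := by rw [natDegree_eq_of_degree_eq_some hg, hm]
  set f : F[X] := X ^ (2 ^ k + 1) + g with hf
  have hfg : ∀ j, j ≠ 2 * e + 3 → f.coeff j = g.coeff j := fun j hj => by
    rw [hf, hd, coeff_add, coeff_X_pow, if_neg hj, zero_add]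
  have hf1 : f.coeff (2 * e + 3) = 1 := by
    rw [hf, hd, coeff_add, coeff_X_pow_self, coeff_eq_zero_of_natDegree_lt (by omega), add_zero]
  have hf0 : ∀ j, e + 3 < j → j ≠ 2 * e + 3 → f.coeff j = 0 := fun j h1 h2 => by
    rw [hfg j h2, coeff_eq_zero_of_natDegree_lt (by omega)]
  have hfm : f.coeff (e + 3) ≠ 0 := by
    rw [hfg _ (by omega), ← hgdeg]
    refine leadingCoeff_ne_zero.2 ?_
    rintro rfl
    simp at hgdeg
  have : CharP (AlgebraicClosure F) 2 := charP_of_injective_algebraMap' F 2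
  let ι : F →+* AlgebraicClosure F := algebraMap F (AlgebraicClosure F)
  have hf1' : (f.map ι).coeff (2 * e + 3) = 1 := by rw [coeff_map, hf1, map_one]
  have hf0' : ∀ j, e + 3 < j → j ≠ 2 * e + 3 → (f.map ι).coeff j = 0 := fun j h1 h2 => by
    rw [coeff_map, hf0 j h1 h2, map_zero]
  have hfm' : (f.map ι).coeff (e + 3) ≠ 0 := by
    rw [coeff_map]
    exact (map_ne_zero ι).2 hfm
  have hdeg := totalDegree_phi he hf1' hf0'
  have hphi : phi (f.map ι) ≠ 0 := by
    intro h0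
    rw [h0, MvPolynomial.totalDegree_zero] at hdeg
    omega
  have hunit : ¬ IsUnit (MvPolynomial.map ι (phi f)) := by
    rw [map_phi, MvPolynomial.isUnit_iff_totalDegree_of_isReduced, hdeg]
    omega
  by_cases hirr : AbsolutelyIrreducible (phi f)
  · exact ⟨fun _ => hirr, fun _ => Or.inl hirr⟩
  obtain ⟨P, Q, hPQ, hP, hQ⟩ : ∃ P Q, MvPolynomial.map ι (phi f) = P * Q ∧
      ¬ IsUnit P ∧ ¬ IsUnit Q := by
    by_contra! hno
    refine hirr ⟨hunit, fun P Q hPQ => ?_⟩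
    by_contra! hu
    exact hu.2 (hno P Q hPQ hu.1)
  refine ⟨fun hnot => absurd ?_ hnot, fun _ => Or.inr
    (exists_factorization_of_map_phi_eq_mul hF hk hk1 he hf1 hf0 hfm hPQ hP hQ)⟩
  rw [map_phi] at hPQ
  obtain ⟨-, -, h3, hrest⟩ := boundary_of_phi_eq_mul hk hk1 he hf1' hf0' hfm' hphi hPQ hP hQ
  apply hasBoundaryForm_of_coeff hk3
  · rw [hm, ← hfg 3 (by omega), ← hfg (e + 3) (by omega)]
    apply ι.injective
    rw [map_pow, ← coeff_map, ← coeff_map, h3]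
  · intro j hj1 hj2 hj3
    have hlt : j < e + 3 := by
      have := le_natDegree_of_ne_zero hj3
      omega
    refine hrest j hj1 hlt ?_
    rw [coeff_map, hfg j (by omega)]
    exact (map_ne_zero ι).2 hj3
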